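/- Let $\mathbb C$ be a (Barr-)exact category: $\mathbb C$ has finite limits, every morphism factors as a regular epimorphism followed by a monomorphism, regular epimorphisms are stable under pullback, and every internal equivalence relation is the kernel pair of some morphism. An internal preorder $(A,\rho)$ in $\mathbb C$ is a reflexive and transitive internal relation $\langle r_1,r_2\rangle\colon\rho\rightarrowtail A\times A$; a morphism $(A,\rho)\to(B,\sigma)$ is a pair $(f,\bar f)$ with $f\colon A\to B$, $\bar f\colon\rho\to\sigma$, $s_i\bar f=f r_i$ $(i=1,2)$. This gives the category $\mathsf{PreOrd}(\mathbb C)$. Write $\sim_\rho\,=\rho\wedge\rho^o$ for the intersection, as subobjects of $A\times A$, of $\rho$ with its opposite $\rho^o=\langle r_2,r_1\rangle$. Let $\mathsf{ParOrd}(\mathbb C)$ be the full subcategory of $\mathsf{PreOrd}(\mathbb C)$ on the internal partial orders, i.e. those $(A,\rho)$ for which $\sim_\rho$ is the discrete relation $\Delta_A=\langle 1_A,1_A\rangle$. Then $\mathsf{ParOrd}(\mathbb C)$ is a reflective subcategory of $\mathsf{PreOrd}(\mathbb C)$: the inclusion $U\colon\mathsf{ParOrd}(\mathbb C)\to\mathsf{PreOrd}(\mathbb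 C)$ has a left adjoint. Moreover, for every left adjoint $F\dashv U$ and every internal preorder $(A,\rho)$, the $(A,\rho)$-component of the unit is (up to the choice of the coequalizer and of the image) the canonical quotient $(\pi,\bar\pi)\colon(A,\rho)\to(A/{\sim_\rho},\pi(\rho))$, where $\pi$ is a coequalizer of the two projections $\sim_\rho\rightrightarrows A$ and $\pi(\rho)$ is the regular image of $\rho$ along $\pi$ (so $\bar\pi$ is a regular epimorphism in $\mathbb C$). This unit component is a regular epimorphism in $\mathsf{PreOrd}(\mathbb C)$, and each of its pullbacks in $\mathsf{PreOrd}(\mathbb C)$ is again a regular epimorphism. In particular $\mathsf{ParOrd}(\mathbb C)$ is (regular epi)-reflective in $\mathsf{PreOrd}(\mathbb C)$. -/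

import Mathlib

open CategoryTheory CategoryTheory.Limits

universe v u

/-- A (Barr-)exact category: a regular category in which every internal equivalence relation
is effective, i.e. is the kernel pair of some morphism. -/
class BarrExact (C : Type u) [Category.{v} C] : Prop extends Regular C where
  effective : ∀ {R X : C} (r₁ r₂ : R ⟶ X), IsEquivalenceRelation r₁ r₂ →
    ∃ (Y : C) (f : X ⟶ Y), IsKernelPair f r₁ r₂

/-- An internal preorder `(A, ρ)` in `C`: a jointly monic pair `r₁, r₂ : ρ ⟶ A` that is
reflexive and transitive. -/
structure InternalPreorder (C : Type u) [Category.{v} C] where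
  /-- the underlying object `A` -/
  carrier : C
  /-- the object `ρ` of related pairs -/
  rel : C
  /-- the first leg of the relation -/
  r₁ : rel ⟶ carrier
  /-- the second leg of the relation -/
  r₂ : rel ⟶ carrier
  jointlyMono : JointlyMono₂ r₁ r₂
  refl : Nonempty (ReflexiveRelation r₁ r₂)
  trans : Nonempty (TransitiveRelation r₁ r₂)

namespace InternalPreorder

section Category

variable {C : Type u} [Category.{v} C]

/-- A morphism `(A, ρ) ⟶ (B, σ)` of internal preorders: a pair `(f, f')` with `f : A ⟶ B` and
`f' : ρ ⟶ σ` compatible with both legs. -/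
structure Hom (P Q : InternalPreorder C) where
  /-- the morphism `f : A ⟶ B` -/
  base : P.carrier ⟶ Q.carrier
  /-- the morphism `f' : ρ ⟶ σ` -/
  onRel : P.rel ⟶ Q.rel
  comm₁ : onRel ≫ Q.r₁ = P.r₁ ≫ base
  comm₂ : onRel ≫ Q.r₂ = P.r₂ ≫ base

/-- A morphism of internal preorders is determined by its underlying morphism `f`. -/
theorem Hom.ext' {P Q : InternalPreorder C} {f g : Hom P Q} (h : f.base = g.base) : f = g := by
  have h' : f.onRel = g.onRel := Q.jointlyMono.right_cancellation _ _
    (by rw [f.comm₁, g.comm₁, h]) (by rw [f.comm₂, g.comm₂, h])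
  cases f
  cases g
  cases h
  cases h'
  rfl

/-- The category `PreOrd(C)` of internal preorders in `C`. -/
instance : Category (InternalPreorder C) where
  Hom := Hom
  id P := ⟨𝟙 _, 𝟙 _, by simp, by simp⟩
  comp f g := ⟨f.base ≫ g.base, f.onRel ≫ g.onRel,
    by rw [Category.assoc, g.comm₁, ← Category.assoc, f.comm₁, Category.assoc],
    by rw [Category.assoc, g.comm₂, ← Category.assoc, f.comm₂, Category.assoc]⟩
  id_comp _ := Hom.ext' (Category.id_comp _)
  comp_id _ := Hom.ext' (Category.comp_id _)
  assoc _ _ _ := Hom.ext' (Category.assoc _ _ _)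

end Category

section Sim

variable {C : Type u} [Category.{v} C] [HasFiniteLimits C]

/-- The object of the relation `∼ρ = ρ ∧ ρᵒ` on `A`: the pullback of `⟨r₁, r₂⟩ : ρ ⟶ A × A`
along `⟨r₂, r₁⟩ : ρ ⟶ A × A`. -/
noncomputable abbrev sim (P : InternalPreorder C) : C :=
  pullback (prod.lift P.r₁ P.r₂) (prod.lift P.r₂ P.r₁)

/-- The inclusion of `∼ρ` in `A × A`: the diagonal of the pullback square defining `∼ρ`. -/
noncomputable abbrev simι (P : InternalPreorder C) : P.sim ⟶ P.carrier ⨯ P.carrier :=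
  pullback.fst (prod.lift P.r₁ P.r₂) (prod.lift P.r₂ P.r₁) ≫ prod.lift P.r₁ P.r₂

/-- The first projection `∼ρ ⟶ A`. -/
noncomputable abbrev sim₁ (P : InternalPreorder C) : P.sim ⟶ P.carrier := P.simι ≫ prod.fst

/-- The second projection `∼ρ ⟶ A`. -/
noncomputable abbrev sim₂ (P : InternalPreorder C) : P.sim ⟶ P.carrier := P.simι ≫ prod.snd

/-- `(A, ρ)` is an internal partial order when `∼ρ` is the discrete relation
`⟨1, 1⟩ : A ⟶ A × A` (as a subobject of `A × A`). -/
def isPartialOrder (C : Type u) [Category.{v} C] [HasFiniteLimits C] :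
    ObjectProperty (InternalPreorder C) :=
  fun P => ∃ e : P.sim ≅ P.carrier, e.hom ≫ prod.lift (𝟙 _) (𝟙 _) = P.simι

/-- `q : (A, ρ) ⟶ (B, σ)` is the canonical quotient `(π, π') : (A, ρ) ⟶ (A/∼ρ, π(ρ))`:
its underlying morphism `π` is a coequalizer of `∼ρ ⇉ A`, and `σ` is the regular image of `ρ`
along `π`. As `⟨s₁, s₂⟩ : σ ⟶ B × B` is monic and `⟨s₁, s₂⟩ ∘ π' = (π × π) ∘ ⟨r₁, r₂⟩`,
the latter says that `π'` is a regular epimorphism in `C`. -/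
structure IsCanonicalQuotient {P Q : InternalPreorder C} (q : P ⟶ Q) : Prop where
  condition : P.sim₁ ≫ Hom.base q = P.sim₂ ≫ Hom.base q
  isCoequalizer : Nonempty (IsColimit (Cofork.ofπ (Hom.base q) condition))
  isRegularEpi_onRel : IsRegularEpi (Hom.onRel q)

end Sim

end InternalPreorder

/-- The full subcategory `ParOrd(C)` of `PreOrd(C)` on the internal partial orders. -/
abbrev InternalPartialOrder (C : Type u) [Category.{v} C] [HasFiniteLimits C] :=
  (InternalPreorder.isPartialOrder C).FullSubcategory

/-- The forgetful (inclusion) functor `U : ParOrd(C) ⥤ PreOrd(C)`. -/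
abbrev InternalPartialOrder.forget (C : Type u) [Category.{v} C] [HasFiniteLimits C] :
    InternalPartialOrder C ⥤ InternalPreorder C :=
  (InternalPreorder.isPartialOrder C).ι

/-! The argument runs as for sets, with generalized elements: an internal relation is stable under
restriction (`Related.comp`) and can be tested after a regular epimorphism (`Related.descend`).

By exactness `∼ρ` is the kernel pair of its coequalizer `π`, so `π` identifies exactly the elements
that are below each other. Two lifts of one element of `A/∼ρ` are therefore comparable both ways,
which makes the image `π(ρ)` transitive and antisymmetric (`exists_canonicalQuotient`). A morphism
to a partial order coequalizes `∼ρ ⇉ A`, hence factors uniquely through `π`, and the factorization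
is monotone because relatedness descends along `π'` (`IsCanonicalQuotient.existsUnique_desc`). Any
other unit differs from this one by an isomorphism.

For stability, pullbacks of preorders are componentwise, so in a regular category they preserve the
property that both components are regular epimorphisms. That property suffices for being a regular
epimorphism of preorders (`isRegularEpi_of_components`). -/

/-- Generalized elements `x, y : T ⟶ X` are related by `r₁, r₂ : R ⟶ X` when the pair `(x, y)`
factors through `(r₁, r₂)`. -/
def Related {C : Type u} [Category.{v} C] {R X T : C} (r₁ r₂ : R ⟶ X) (x y : T ⟶ X) : Prop :=
  ∃ t : T ⟶ R, t ≫ r₁ = x ∧ t ≫ r₂ = y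

namespace Related

variable {C : Type u} [Category.{v} C] {R X T : C} {r₁ r₂ : R ⟶ X}

theorem comp {x y : T ⟶ X} (h : Related r₁ r₂ x y) {S : C} (s : S ⟶ T) :
    Related r₁ r₂ (s ≫ x) (s ≫ y) := by
  obtain ⟨t, rfl, rfl⟩ := h
  exact ⟨s ≫ t, Category.assoc _ _ _, Category.assoc _ _ _⟩

theorem legs : Related r₁ r₂ r₁ r₂ := ⟨𝟙 _, Category.id_comp _, Category.id_comp _⟩

/-- Relatedness with respect to a jointly monic pair descends along regular epimorphisms. -/
theorem descend (hr : JointlyMono₂ r₁ r₂) {S : C} (e : S ⟶ T) [IsRegularEpi e] {x y : T ⟶ X}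
    (h : Related r₁ r₂ (e ≫ x) (e ≫ y)) : Related r₁ r₂ x y := by
  obtain ⟨t, h₁, h₂⟩ := h
  -- Joint monicity makes the witness `t` unique, so it coequalizes the pair presenting `e`.
  have ht : IsRegularEpi.left e ≫ t = IsRegularEpi.right e ≫ t := by
    apply hr.right_cancellation
    · simp only [Category.assoc, h₁, reassoc_of% (IsRegularEpi.w e)]
    · simp only [Category.assoc, h₂, reassoc_of% (IsRegularEpi.w e)]
  have fac : e ≫ IsRegularEpi.desc e t ht = t := IsRegularEpi.fac e t ht
  have : Epi e := (IsRegularEpi.getStruct e).epi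
  refine ⟨IsRegularEpi.desc e t ht, ?_, ?_⟩
  · rw [← cancel_epi e, reassoc_of% fac, h₁]
  · rw [← cancel_epi e, reassoc_of% fac, h₂]

end Related

section Relations

theorem nonempty_reflexiveRelation {C : Type u} [Category.{v} C] {R X : C} {r₁ r₂ : R ⟶ X}
    (hr : JointlyMono₂ r₁ r₂) (h : Related r₁ r₂ (𝟙 X) (𝟙 X)) :
    Nonempty (ReflexiveRelation r₁ r₂) := by
  obtain ⟨t, h₁, h₂⟩ := h
  exact ⟨{ hr with r := t, reflexivity₁ := h₁, reflexivity₂ := h₂ }⟩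

variable {C : Type u} [Category.{v} C] [HasFiniteLimits C] {R X : C} {r₁ r₂ : R ⟶ X}

theorem nonempty_transitiveRelation (hr : JointlyMono₂ r₁ r₂)
    (h : ∀ {T : C} {x y z : T ⟶ X}, Related r₁ r₂ x y → Related r₁ r₂ y z → Related r₁ r₂ x z) :
    Nonempty (TransitiveRelation r₁ r₂) := by
  obtain ⟨t, h₁, h₂⟩ := h (x := pullback.fst r₂ r₁ ≫ r₁) (y := pullback.fst r₂ r₁ ≫ r₂)
    (z := pullback.snd r₂ r₁ ≫ r₂) ⟨_, rfl, rfl⟩ ⟨_, pullback.condition.symm, rfl⟩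
  exact ⟨{ hr with
    c := PullbackCone.mk _ _ pullback.condition
    isLimit := pullbackIsPullback r₂ r₁
    t := t
    transitivity₁ := h₁
    transitivity₂ := h₂ }⟩

theorem isEquivalenceRelation_of_related (hr : JointlyMono₂ r₁ r₂)
    (hrefl : Related r₁ r₂ (𝟙 X) (𝟙 X)) (hsymm : Related r₁ r₂ r₂ r₁)
    (htrans : ∀ {T : C} {x y z : T ⟶ X},
      Related r₁ r₂ x y → Related r₁ r₂ y z → Related r₁ r₂ x z) :
    IsEquivalenceRelation r₁ r₂ := by
  obtain ⟨a⟩ := nonempty_reflexiveRelation hr hrefl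
  obtain ⟨c⟩ := nonempty_transitiveRelation hr htrans
  obtain ⟨s, h₁, h₂⟩ := hsymm
  exact ⟨⟨{ a, c with s := s, symmetry₁ := h₁, symmetry₂ := h₂ }⟩⟩

end Relations

/-! ### Internal preorders on generalized elements -/

namespace InternalPreorder

section Basic

variable {C : Type u} [Category.{v} C]

@[simp]
theorem comp_base {P Q R : InternalPreorder C} (f : P ⟶ Q) (g : Q ⟶ R) :
    Hom.base (f ≫ g) = Hom.base f ≫ Hom.base g := rfl

@[simp]
theorem comp_onRel {P Q R : InternalPreorder C} (f : P ⟶ Q) (g : Q ⟶ R) :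
    Hom.onRel (f ≫ g) = Hom.onRel f ≫ Hom.onRel g := rfl

@[simp]
theorem id_base (P : InternalPreorder C) : Hom.base (𝟙 P) = 𝟙 P.carrier := rfl

@[simp]
theorem id_onRel (P : InternalPreorder C) : Hom.onRel (𝟙 P) = 𝟙 P.rel := rfl

theorem hom_ext {P Q : InternalPreorder C} {f g : P ⟶ Q} (h : Hom.base f = Hom.base g) : f = g :=
  Hom.ext' h

instance {P Q : InternalPreorder C} (f : P ⟶ Q) [IsIso f] : IsIso (Hom.base f) :=
  ⟨Hom.base (inv f), by rw [← comp_base, IsIso.hom_inv_id, id_base],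
    by rw [← comp_base, IsIso.inv_hom_id, id_base]⟩

instance {P Q : InternalPreorder C} (f : P ⟶ Q) [IsIso f] : IsIso (Hom.onRel f) :=
  ⟨Hom.onRel (inv f), by rw [← comp_onRel, IsIso.hom_inv_id, id_onRel],
    by rw [← comp_onRel, IsIso.inv_hom_id, id_onRel]⟩

theorem exists_hom {P Q : InternalPreorder C} (f : P.carrier ⟶ Q.carrier)
    (h : Related Q.r₁ Q.r₂ (P.r₁ ≫ f) (P.r₂ ≫ f)) : ∃ g : P ⟶ Q, Hom.base g = f := by
  obtain ⟨t, h₁, h₂⟩ := h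
  exact ⟨(⟨f, t, h₁, h₂⟩ : Hom P Q), rfl⟩

/-- The relation of an internal preorder on generalized elements. -/
abbrev Le (P : InternalPreorder C) {T : C} (x y : T ⟶ P.carrier) : Prop := Related P.r₁ P.r₂ x y

theorem le_refl (P : InternalPreorder C) {T : C} (x : T ⟶ P.carrier) : P.Le x x := by
  obtain ⟨h⟩ := P.refl
  exact ⟨x ≫ h.r, by simp, by simp⟩

theorem Le.trans {P : InternalPreorder C} {T : C} {x y z : T ⟶ P.carrier} (h : P.Le x y)
    (h' : P.Le y z) : P.Le x z := by
  obtain ⟨w⟩ := P.trans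
  obtain ⟨t, rfl, rfl⟩ := h
  obtain ⟨t', h₁, rfl⟩ := h'
  obtain ⟨l, hl₁, hl₂⟩ := PullbackCone.IsLimit.lift' w.isLimit t t' h₁.symm
  exact ⟨l ≫ w.t, by simp [reassoc_of% hl₁], by simp [reassoc_of% hl₂]⟩

theorem Le.map {P Q : InternalPreorder C} {T : C} {x y : T ⟶ P.carrier} (h : P.Le x y)
    (f : P ⟶ Q) : Q.Le (x ≫ Hom.base f) (y ≫ Hom.base f) := by
  obtain ⟨t, rfl, rfl⟩ := h
  exact ⟨t ≫ Hom.onRel f, by rw [Category.assoc, Hom.comm₁, Category.assoc],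
    by rw [Category.assoc, Hom.comm₂, Category.assoc]⟩

end Basic

section FiniteLimits

variable {C : Type u} [Category.{v} C] [HasFiniteLimits C]

/-- An internal preorder from a jointly monic pair that is reflexive and transitive on
generalized elements. -/
abbrev ofRelated {A ρ : C} (r₁ r₂ : ρ ⟶ A) (hr : JointlyMono₂ r₁ r₂)
    (hrefl : Related r₁ r₂ (𝟙 A) (𝟙 A))
    (htrans : ∀ {T : C} {x y z : T ⟶ A},
      Related r₁ r₂ x y → Related r₁ r₂ y z → Related r₁ r₂ x z) : InternalPreorder C where
  carrier := A
  rel := ρ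
  r₁ := r₁
  r₂ := r₂
  jointlyMono := hr
  refl := nonempty_reflexiveRelation hr hrefl
  trans := nonempty_transitiveRelation hr htrans

/-! ### The equivalence relation `∼ρ` and antisymmetry -/

section Sim

variable (P : InternalPreorder C)

theorem sim₁_eq_fst : P.sim₁ = pullback.fst _ _ ≫ P.r₁ := by
  rw [sim₁, simι, Category.assoc, prod.lift_fst]

theorem sim₂_eq_fst : P.sim₂ = pullback.fst _ _ ≫ P.r₂ := by
  rw [sim₂, simι, Category.assoc, prod.lift_snd]

theorem sim₁_eq_snd : P.sim₁ = pullback.snd _ _ ≫ P.r₂ := by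
  rw [sim₁, simι, pullback.condition, Category.assoc, prod.lift_fst]

theorem sim₂_eq_snd : P.sim₂ = pullback.snd _ _ ≫ P.r₁ := by
  rw [sim₂, simι, pullback.condition, Category.assoc, prod.lift_snd]

theorem related_sim_iff {T : C} {x y : T ⟶ P.carrier} :
    Related P.sim₁ P.sim₂ x y ↔ P.Le x y ∧ P.Le y x := by
  constructor
  · rintro ⟨t, rfl, rfl⟩
    refine ⟨⟨t ≫ pullback.fst _ _, ?_, ?_⟩, ⟨t ≫ pullback.snd _ _, ?_, ?_⟩⟩
    · rw [sim₁_eq_fst, Category.assoc]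
    · rw [sim₂_eq_fst, Category.assoc]
    · rw [sim₂_eq_snd, Category.assoc]
    · rw [sim₁_eq_snd, Category.assoc]
  · rintro ⟨⟨t, rfl, rfl⟩, ⟨t', h, h'⟩⟩
    refine ⟨pullback.lift t t' ?_, ?_, ?_⟩
    · rw [prod.comp_lift, prod.comp_lift, h, h']
    · rw [sim₁_eq_fst, pullback.lift_fst_assoc]
    · rw [sim₂_eq_fst, pullback.lift_fst_assoc]

theorem jointlyMono_sim : JointlyMono₂ P.sim₁ P.sim₂ where
  right_cancellation T f g h₁ h₂ := by
    apply pullback.hom_ext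
    · apply P.jointlyMono.right_cancellation
      · rw [Category.assoc, Category.assoc, ← sim₁_eq_fst, h₁]
      · rw [Category.assoc, Category.assoc, ← sim₂_eq_fst, h₂]
    · apply P.jointlyMono.right_cancellation
      · rw [Category.assoc, Category.assoc, ← sim₂_eq_snd, h₂]
      · rw [Category.assoc, Category.assoc, ← sim₁_eq_snd, h₁]

theorem isEquivalenceRelation_sim : IsEquivalenceRelation P.sim₁ P.sim₂ := by
  apply isEquivalenceRelation_of_related P.jointlyMono_sim
  · exact P.related_sim_iff.2 ⟨P.le_refl _, P.le_refl _⟩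
  · exact P.related_sim_iff.2 (P.related_sim_iff.1 Related.legs).symm
  · intro T x y z h h'
    rw [related_sim_iff] at *
    exact ⟨Le.trans h.1 h'.1, Le.trans h'.2 h.2⟩

/-- For the converse, antisymmetry makes the two legs of `∼ρ` equal; reflexivity then supplies an
inverse of this common leg. -/
theorem isPartialOrder_iff :
    isPartialOrder C P ↔ ∀ {T : C} {x y : T ⟶ P.carrier}, P.Le x y → P.Le y x → x = y := by
  constructor
  · rintro ⟨e, he⟩ T x y h h'
    obtain ⟨t, rfl, rfl⟩ := P.related_sim_iff.2 ⟨h, h'⟩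
    rw [sim₁, sim₂, ← he, Category.assoc, Category.assoc, prod.lift_fst, prod.lift_snd]
  · intro h
    have hs := P.related_sim_iff.1 Related.legs
    have heq : P.sim₁ = P.sim₂ := h hs.1 hs.2
    obtain ⟨t, h₁, h₂⟩ := P.related_sim_iff.2 ⟨P.le_refl (𝟙 _), P.le_refl (𝟙 _)⟩
    refine ⟨⟨P.sim₁, t, ?_, h₁⟩, ?_⟩
    · apply P.jointlyMono_sim.right_cancellation
      · rw [Category.assoc, h₁, Category.comp_id, Category.id_comp]
      · rw [Category.assoc, h₂, Category.comp_id, Category.id_comp, heq]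
    · apply Limits.prod.hom_ext
      · rw [Category.assoc, prod.lift_fst, Category.comp_id]
      · rw [Category.assoc, prod.lift_snd, Category.comp_id]
        exact heq

theorem sim_comp_eq {P Q : InternalPreorder C} (hQ : isPartialOrder C Q) (f : P ⟶ Q) :
    P.sim₁ ≫ Hom.base f = P.sim₂ ≫ Hom.base f := by
  have h := P.related_sim_iff.1 Related.legs
  exact Q.isPartialOrder_iff.1 hQ (h.1.map f) (h.2.map f)

end Sim

/-! ### Componentwise pullbacks of preorders -/

section Pullback

variable {P Q R : InternalPreorder C} (f : P ⟶ R) (g : Q ⟶ R)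

/-- The first leg of the componentwise pullback relation. -/
noncomputable def pullbackR₁ : pullback (Hom.onRel f) (Hom.onRel g) ⟶
    pullback (Hom.base f) (Hom.base g) :=
  pullback.map _ _ _ _ P.r₁ Q.r₁ R.r₁ (Hom.comm₁ f) (Hom.comm₁ g)

/-- The second leg of the componentwise pullback relation. -/
noncomputable def pullbackR₂ : pullback (Hom.onRel f) (Hom.onRel g) ⟶
    pullback (Hom.base f) (Hom.base g) :=
  pullback.map _ _ _ _ P.r₂ Q.r₂ R.r₂ (Hom.comm₂ f) (Hom.comm₂ g)

@[simp]
theorem pullbackR₁_fst : pullbackR₁ f g ≫ pullback.fst _ _ = pullback.fst _ _ ≫ P.r₁ :=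
  pullback.lift_fst _ _ _

@[simp]
theorem pullbackR₁_snd : pullbackR₁ f g ≫ pullback.snd _ _ = pullback.snd _ _ ≫ Q.r₁ :=
  pullback.lift_snd _ _ _

@[simp]
theorem pullbackR₂_fst : pullbackR₂ f g ≫ pullback.fst _ _ = pullback.fst _ _ ≫ P.r₂ :=
  pullback.lift_fst _ _ _

@[simp]
theorem pullbackR₂_snd : pullbackR₂ f g ≫ pullback.snd _ _ = pullback.snd _ _ ≫ Q.r₂ :=
  pullback.lift_snd _ _ _

theorem related_pullback_iff {T : C} {x y : T ⟶ pullback (Hom.base f) (Hom.base g)} :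
    Related (pullbackR₁ f g) (pullbackR₂ f g) x y ↔
      P.Le (x ≫ pullback.fst _ _) (y ≫ pullback.fst _ _) ∧
        Q.Le (x ≫ pullback.snd _ _) (y ≫ pullback.snd _ _) := by
  constructor
  · rintro ⟨t, rfl, rfl⟩
    exact ⟨⟨t ≫ pullback.fst _ _, by simp, by simp⟩, ⟨t ≫ pullback.snd _ _, by simp, by simp⟩⟩
  · rintro ⟨⟨t, h₁, h₂⟩, ⟨t', h₁', h₂'⟩⟩
    refine ⟨pullback.lift t t' ?_, ?_, ?_⟩
    -- The witnesses in `P` and `Q` agree in `R.rel` because their endpoints agree in `R`.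
    · apply R.jointlyMono.right_cancellation
      · simp only [Category.assoc, Hom.comm₁, reassoc_of% h₁, reassoc_of% h₁', pullback.condition]
      · simp only [Category.assoc, Hom.comm₂, reassoc_of% h₂, reassoc_of% h₂', pullback.condition]
    · apply pullback.hom_ext
      · rw [Category.assoc, pullbackR₁_fst, pullback.lift_fst_assoc, h₁]
      · rw [Category.assoc, pullbackR₁_snd, pullback.lift_snd_assoc, h₁']
    · apply pullback.hom_ext
      · rw [Category.assoc, pullbackR₂_fst, pullback.lift_fst_assoc, h₂]
      · rw [Category.assoc, pullbackR₂_snd, pullback.lift_snd_assoc, h₂']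

theorem jointlyMono_pullback : JointlyMono₂ (pullbackR₁ f g) (pullbackR₂ f g) where
  right_cancellation T a b h₁ h₂ := by
    apply pullback.hom_ext
    · apply P.jointlyMono.right_cancellation
      · simpa using congrArg (· ≫ pullback.fst _ _) h₁
      · simpa using congrArg (· ≫ pullback.fst _ _) h₂
    · apply Q.jointlyMono.right_cancellation
      · simpa using congrArg (· ≫ pullback.snd _ _) h₁
      · simpa using congrArg (· ≫ pullback.snd _ _) h₂

/-- The componentwise pullback of internal preorders. -/
noncomputable abbrev pullbackObj : InternalPreorder C :=
  ofRelated (pullbackR₁ f g) (pullbackR₂ f g) (jointlyMono_pullback f g)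
    ((related_pullback_iff f g).2 ⟨P.le_refl _, Q.le_refl _⟩)
    (fun h h' => by
      rw [related_pullback_iff] at *
      exact ⟨Le.trans h.1 h'.1, Le.trans h.2 h'.2⟩)

/-- The first projection of the componentwise pullback. -/
noncomputable def pullbackFst : pullbackObj f g ⟶ P :=
  (⟨pullback.fst _ _, pullback.fst _ _, by simp, by simp⟩ : Hom (pullbackObj f g) P)

/-- The second projection of the componentwise pullback. -/
noncomputable def pullbackSnd : pullbackObj f g ⟶ Q :=
  (⟨pullback.snd _ _, pullback.snd _ _, by simp, by simp⟩ : Hom (pullbackObj f g) Q)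

@[simp]
theorem pullbackSnd_base : Hom.base (pullbackSnd f g) = pullback.snd _ _ := rfl

@[simp]
theorem pullbackSnd_onRel : Hom.onRel (pullbackSnd f g) = pullback.snd _ _ := rfl

theorem pullback_condition : pullbackFst f g ≫ f = pullbackSnd f g ≫ g :=
  hom_ext pullback.condition

end Pullback

/-! ### Componentwise regular epimorphisms and canonical quotients -/

/-- A morphism both of whose components are regular epimorphisms is the coequalizer of its
componentwise kernel pair. -/
theorem isRegularEpi_of_components {P Q : InternalPreorder C} (f : P ⟶ Q)
    [IsRegularEpi (Hom.base f)] [IsRegularEpi (Hom.onRel f)] : IsRegularEpi f := by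
  have hb : Epi (Hom.base f) := (IsRegularEpi.getStruct (Hom.base f)).epi
  have hcol := (IsKernelPair.of_hasPullback (Hom.base f)).toCoequalizer'
  have key : ∀ s : Cofork (pullbackFst f f) (pullbackSnd f f),
      ∃ l : Q ⟶ s.pt, f ≫ l = s.π := by
    intro s
    have hs : pullback.fst (Hom.base f) (Hom.base f) ≫ Hom.base s.π =
        pullback.snd (Hom.base f) (Hom.base f) ≫ Hom.base s.π :=
      congrArg Hom.base s.condition
    obtain ⟨d, hd⟩ := Cofork.IsColimit.desc' hcol _ hs
    replace hd : Hom.base f ≫ d = Hom.base s.π := hd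
    -- Monotonicity of `d` can be checked after precomposing with `Hom.onRel f`, where it becomes
    -- monotonicity of `s.π`.
    have hle : Related s.pt.r₁ s.pt.r₂ (Q.r₁ ≫ d) (Q.r₂ ≫ d) := by
      apply Related.descend s.pt.jointlyMono (Hom.onRel f)
      rw [reassoc_of% (Hom.comm₁ f), reassoc_of% (Hom.comm₂ f), hd]
      exact Le.map Related.legs s.π
    obtain ⟨l, hl⟩ := exists_hom d hle
    exact ⟨l, hom_ext (by rw [comp_base, hl, hd])⟩
  refine ⟨⟨{ W := pullbackObj f f
             left := pullbackFst f f
             right := pullbackSnd f f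
             w := pullback_condition f f
             isColimit := Cofork.IsColimit.mk' _ fun s => ?_ }⟩⟩
  choose l hl using key s
  refine ⟨l, hl, fun {m} hm => hom_ext ?_⟩
  rw [← cancel_epi (Hom.base f), ← comp_base, ← comp_base, hl]
  exact congrArg Hom.base hm

/-- Being a canonical quotient is invariant under isomorphisms of the codomain. -/
theorem IsCanonicalQuotient.comp_isIso {P Q R : InternalPreorder C} {q : P ⟶ Q}
    (hq : IsCanonicalQuotient q) (e : Q ⟶ R) [IsIso e] : IsCanonicalQuotient (q ≫ e) where
  condition := by
    rw [comp_base, ← Category.assoc, hq.condition, Category.assoc]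
  isCoequalizer := by
    obtain ⟨h⟩ := hq.isCoequalizer
    exact ⟨IsColimit.ofIsoColimit h (Cofork.ext (asIso (Hom.base e)) rfl)⟩
  isRegularEpi_onRel := by
    have := hq.isRegularEpi_onRel
    exact ((MorphismProperty.regularEpi C).cancel_right_of_respectsIso _ (Hom.onRel e)).2 this

theorem IsCanonicalQuotient.isRegularEpi_base {P Q : InternalPreorder C} {q : P ⟶ Q}
    (hq : IsCanonicalQuotient q) : IsRegularEpi (Hom.base q) :=
  ⟨⟨Cofork.IsColimit.regularEpi hq.isCoequalizer.some⟩⟩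

/-- A canonical quotient has the universal property of the reflection. -/
theorem IsCanonicalQuotient.existsUnique_desc {P Q R : InternalPreorder C} {q : P ⟶ Q}
    (hq : IsCanonicalQuotient q) (hR : isPartialOrder C R) (f : P ⟶ R) :
    ∃! g : Q ⟶ R, q ≫ g = f := by
  have := hq.isRegularEpi_base
  have := hq.isRegularEpi_onRel
  have hb : Epi (Hom.base q) := (IsRegularEpi.getStruct (Hom.base q)).epi
  obtain ⟨hcol⟩ := hq.isCoequalizer
  obtain ⟨d, hd⟩ := Cofork.IsColimit.desc' hcol _ (sim_comp_eq hR f)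
  replace hd : Hom.base q ≫ d = Hom.base f := hd
  have hle : Related R.r₁ R.r₂ (Q.r₁ ≫ d) (Q.r₂ ≫ d) := by
    apply Related.descend R.jointlyMono (Hom.onRel q)
    rw [reassoc_of% (Hom.comm₁ q), reassoc_of% (Hom.comm₂ q), hd]
    exact Le.map Related.legs f
  obtain ⟨l, hl⟩ := exists_hom d hle
  refine ⟨l, hom_ext (by rw [comp_base, hl, hd]), fun m hm => hom_ext ?_⟩
  rw [← cancel_epi (Hom.base q), hl, hd, ← comp_base, hm]

end FiniteLimits

/-! ### Stability under pullback and regular images -/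

section Regular

variable {C : Type u} [Category.{v} C] [Regular C]

theorem isRegularEpi_of_comp {X Y Z : C} (f : X ⟶ Y) (g : Y ⟶ Z) [IsRegularEpi (f ≫ g)] :
    IsRegularEpi g := by
  have : StrongEpi g := strongEpi_of_strongEpi f g
  infer_instance

/-- Pullbacks of componentwise regular epimorphisms of internal preorders are regular
epimorphisms. -/
theorem universally_regularEpi_of_components {P Q : InternalPreorder C} (f : P ⟶ Q)
    [IsRegularEpi (Hom.base f)] [IsRegularEpi (Hom.onRel f)] :
    (MorphismProperty.regularEpi (InternalPreorder C)).universally f := by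
  intro P' Q' i j f' sq
  -- The componentwise pullback maps to the given one over `Q'`. Its projection has regular
  -- epimorphic components, and a regular epimorphic composite forces its last factor to be one.
  obtain ⟨l, hl⟩ : ∃ l, l ≫ f' = pullbackSnd f j :=
    ⟨sq.flip.lift _ _ (pullback_condition f j), sq.flip.lift_snd _ _ _⟩
  have h₁ : IsRegularEpi (Hom.base f') := by
    have : IsRegularEpi (Hom.base l ≫ Hom.base f') := by
      rw [← comp_base, hl, pullbackSnd_base]
      infer_instance
    exact isRegularEpi_of_comp (Hom.base l) _
  have h₂ : IsRegularEpi (Hom.onRel f') := by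
    have : IsRegularEpi (Hom.onRel l ≫ Hom.onRel f') := by
      rw [← comp_onRel, hl, pullbackSnd_onRel]
      infer_instance
    exact isRegularEpi_of_comp (Hom.onRel l) _
  exact isRegularEpi_of_components f'

/-- A regular image of an internal preorder, on generalized elements: related elements are locally
images of related elements. -/
theorem related_image_iff {P : InternalPreorder C} {B σ : C} {p : P.carrier ⟶ B} {s₁ s₂ : σ ⟶ B}
    (hs : JointlyMono₂ s₁ s₂) (p' : P.rel ⟶ σ) [IsRegularEpi p'] (h₁ : p' ≫ s₁ = P.r₁ ≫ p)
    (h₂ : p' ≫ s₂ = P.r₂ ≫ p) {T : C} {u v : T ⟶ B} :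
    Related s₁ s₂ u v ↔ ∃ (T' : C) (e : T' ⟶ T) (x y : T' ⟶ P.carrier), IsRegularEpi e ∧
      P.Le x y ∧ x ≫ p = e ≫ u ∧ y ≫ p = e ≫ v := by
  constructor
  · rintro ⟨t, rfl, rfl⟩
    refine ⟨pullback p' t, pullback.snd _ _, pullback.fst _ _ ≫ P.r₁, pullback.fst _ _ ≫ P.r₂,
      inferInstance, ⟨_, rfl, rfl⟩, ?_, ?_⟩
    · rw [Category.assoc, ← h₁, pullback.condition_assoc]
    · rw [Category.assoc, ← h₂, pullback.condition_assoc]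
  · rintro ⟨T', e, x, y, he, ⟨t, rfl, rfl⟩, hx, hy⟩
    refine Related.descend hs e ⟨t ≫ p', ?_, ?_⟩
    · rw [Category.assoc, h₁, ← hx, Category.assoc]
    · rw [Category.assoc, h₂, ← hy, Category.assoc]

end Regular

/-! ### The quotient by `∼ρ` and the reflection -/

section Exact

variable {C : Type u} [Category.{v} C] [BarrExact C]

/-- The kernel pair of the quotient of `A` by `∼ρ` is `∼ρ`. -/
theorem exists_quotient_sim (P : InternalPreorder C) :
    ∃ (B : C) (p : P.carrier ⟶ B) (w : P.sim₁ ≫ p = P.sim₂ ≫ p),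
      Nonempty (IsColimit (Cofork.ofπ p w)) ∧ IsKernelPair p P.sim₁ P.sim₂ := by
  obtain ⟨Y, f, hf⟩ := BarrExact.effective _ _ P.isEquivalenceRelation_sim
  have : HasCoequalizer P.sim₁ P.sim₂ := Regular.hasCoequalizer_of_isKernelPair hf
  refine ⟨_, coequalizer.π _ _, coequalizer.condition _ _, ⟨coequalizerIsCoequalizer _ _⟩, ?_⟩
  -- Since `f` factors through the coequalizer, a pair that is the kernel pair of `f` and is
  -- coequalized by the quotient is also the kernel pair of the quotient.
  apply IsKernelPair.cancel_right (f₂ := coequalizer.desc f hf.w) (coequalizer.condition _ _)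
  rwa [coequalizer.π_desc]

/-- Every internal preorder in an exact category has a canonical quotient, and it is an internal
partial order. -/
theorem exists_canonicalQuotient (P : InternalPreorder C) :
    ∃ (Q : InternalPreorder C) (q : P ⟶ Q), isPartialOrder C Q ∧ IsCanonicalQuotient q := by
  obtain ⟨B, p, w, ⟨hcol⟩, hker⟩ := P.exists_quotient_sim
  have hp : IsRegularEpi p := ⟨⟨Cofork.IsColimit.regularEpi hcol⟩⟩
  have hle : ∀ {T : C} {x y : T ⟶ P.carrier}, x ≫ p = y ≫ p → P.Le x y ∧ P.Le y x := by
    intro T x y h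
    exact P.related_sim_iff.1 ⟨hker.lift x y h, hker.lift_fst _ _ _, hker.lift_snd _ _ _⟩
  have heq : ∀ {T : C} {x y : T ⟶ P.carrier}, P.Le x y → P.Le y x → x ≫ p = y ≫ p := by
    intro T x y h h'
    obtain ⟨t, ht, ht'⟩ := P.related_sim_iff.2 ⟨h, h'⟩
    rw [← ht, ← ht', Category.assoc t, w, Category.assoc t]
  -- The image of `ρ` in `B × B`; its strong epimorphic part is regular.
  let F := Regular.strongEpiMonoFactorisation (prod.lift (P.r₁ ≫ p) (P.r₂ ≫ p))
  have hF : IsRegularEpi F.e := inferInstance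
  have hs : JointlyMono₂ (F.m ≫ prod.fst) (F.m ≫ prod.snd) := by
    refine ⟨fun T f g h₁ h₂ => ?_⟩
    rw [← cancel_mono F.m]
    apply Limits.prod.hom_ext
    · rw [Category.assoc, h₁, Category.assoc]
    · rw [Category.assoc, h₂, Category.assoc]
  have h₁ : F.e ≫ F.m ≫ prod.fst = P.r₁ ≫ p := by rw [F.fac_assoc, prod.lift_fst]
  have h₂ : F.e ≫ F.m ≫ prod.snd = P.r₂ ≫ p := by rw [F.fac_assoc, prod.lift_snd]
  have himg : ∀ {T : C} {u v : T ⟶ B}, Related (F.m ≫ prod.fst) (F.m ≫ prod.snd) u v ↔ _ :=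
    fun {T u v} => related_image_iff hs F.e h₁ h₂
  let Q : InternalPreorder C := ofRelated (F.m ≫ prod.fst) (F.m ≫ prod.snd) hs
    (himg.2 ⟨P.carrier, p, 𝟙 _, 𝟙 _, hp, P.le_refl _, by simp, by simp⟩)
    (by
      intro T u v z h h'
      obtain ⟨T', e, x, y, he, hxy, hx, hy⟩ := himg.1 h
      obtain ⟨T'', e', y', z', he', hyz, hy', hz'⟩ := himg.1 (h'.comp e)
      apply Related.descend hs e
      refine himg.2 ⟨T'', e', e' ≫ x, z', he', ?_, by rw [Category.assoc, hx], hz'⟩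
      -- The two lifts `y` and `y'` of the middle element have the same image under `p`, hence are
      -- comparable, and this bridges the two inequalities.
      have hyy : (e' ≫ y) ≫ p = y' ≫ p := by rw [Category.assoc, hy, hy']
      exact Le.trans (Le.trans (hxy.comp e') (hle hyy).1) hyz)
  refine ⟨Q, (⟨p, F.e, h₁, h₂⟩ : Hom P Q), ?_, ⟨w, ⟨hcol⟩, hF⟩⟩
  rw [isPartialOrder_iff]
  intro T u v h h'
  obtain ⟨T', e, x, y, he, hxy, hx, hy⟩ := himg.1 h
  obtain ⟨T'', e', y', x', he', hyx, hy', hx'⟩ := himg.1 (h'.comp e)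
  have hyy : (e' ≫ y) ≫ p = y' ≫ p := by rw [Category.assoc, hy, hy']
  have hxx : x' ≫ p = (e' ≫ x) ≫ p := by rw [Category.assoc, hx, hx']
  -- The chain `y ≤ y' ≤ x' ≤ x` over `T''` reverses `x ≤ y`, so `p` identifies `x` and `y`.
  have hfin := heq (hxy.comp e') (Le.trans (Le.trans (hle hyy).1 hyx) (hle hxx).1)
  have : Epi e := (IsRegularEpi.getStruct e).epi
  have : Epi e' := (IsRegularEpi.getStruct e').epi
  rw [← cancel_epi e, ← cancel_epi e', ← hx, ← hy, ← Category.assoc, ← Category.assoc, hfin]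

/-- The universal property says that the canonical quotient is initial among arrows from `P` to
partial orders. -/
theorem isRightAdjoint_forget : (InternalPartialOrder.forget C).IsRightAdjoint := by
  rw [isRightAdjoint_iff_hasInitial_structuredArrow]
  intro P
  obtain ⟨Q, q, hQ, hq⟩ := P.exists_canonicalQuotient
  let X : StructuredArrow P (InternalPartialOrder.forget C) :=
    StructuredArrow.mk (Y := (⟨Q, hQ⟩ : InternalPartialOrder C)) q
  have key : ∀ Z : StructuredArrow P (InternalPartialOrder.forget C), Nonempty (Unique (X ⟶ Z)) := by
    intro Z
    obtain ⟨g, hg, huniq⟩ := hq.existsUnique_desc Z.right.property Z.hom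
    refine ⟨⟨⟨StructuredArrow.homMk (ObjectProperty.homMk g) hg⟩, fun m => ?_⟩⟩
    apply StructuredArrow.hom_ext
    apply (InternalPartialOrder.forget C).map_injective
    exact huniq _ (StructuredArrow.w m)
  have := fun Z => (key Z).some
  exact hasInitial_of_unique X

/-- Every unit component of an adjunction exhibiting internal partial orders as reflective in
internal preorders is a canonical quotient. -/
theorem isCanonicalQuotient_unit {F : InternalPreorder C ⥤ InternalPartialOrder C}
    (adj : F ⊣ InternalPartialOrder.forget C) (P : InternalPreorder C) :
    IsCanonicalQuotient (adj.unit.app P) := by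
  obtain ⟨Q, q, hQ, hq⟩ := P.exists_canonicalQuotient
  let Q' : InternalPartialOrder C := ⟨Q, hQ⟩
  obtain ⟨e, he, -⟩ := hq.existsUnique_desc (F.obj P).property (adj.unit.app P)
  let d : F.obj P ⟶ Q' := (adj.homEquiv P Q').symm q
  have hd : adj.unit.app P ≫ (InternalPartialOrder.forget C).map d = q := by
    exact (adj.homEquiv_unit P Q' d).symm.trans ((adj.homEquiv P Q').apply_symm_apply q)
  -- The unit and `q` are both universal from `P` to partial orders, so the comparisons `e` and `d`
  -- are mutually inverse.
  have : IsIso e := by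
    refine ⟨(InternalPartialOrder.forget C).map d, ?_, ?_⟩
    · apply (hq.existsUnique_desc hQ q).unique
      · rw [reassoc_of% he, hd]
      · rw [Category.comp_id]
    · have : d ≫ ObjectProperty.homMk e = 𝟙 (F.obj P) := by
        apply (adj.homEquiv _ _).injective
        rw [adj.homEquiv_unit, adj.homEquiv_unit, Functor.map_comp, reassoc_of% hd,
          CategoryTheory.Functor.map_id]
        exact he.trans (Category.comp_id _).symm
      exact congrArg (InternalPartialOrder.forget C).map this
  rw [← he]
  exact hq.comp_isIso e

end Exact

end InternalPreorder

theorem mainTheorem7 (C : Type u) [Category.{v} C] [BarrExact C] :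
    Nonempty (Reflective (InternalPartialOrder.forget C)) ∧
      ∀ (F : InternalPreorder C ⥤ InternalPartialOrder C)
        (adj : F ⊣ InternalPartialOrder.forget C) (P : InternalPreorder C),
        InternalPreorder.IsCanonicalQuotient (adj.unit.app P) ∧
        IsRegularEpi (adj.unit.app P) ∧
        (MorphismProperty.regularEpi (InternalPreorder C)).universally (adj.unit.app P) := by
  have := InternalPreorder.isRightAdjoint_forget (C := C)
  refine ⟨⟨⟨_, Adjunction.ofIsRightAdjoint _⟩⟩, fun F adj P => ?_⟩
  · have hq := InternalPreorder.isCanonicalQuotient_unit adj P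
    have := hq.isRegularEpi_base
    have := hq.isRegularEpi_onRel
    have huniv := InternalPreorder.universally_regularEpi_of_components (adj.unit.app P)
    exact ⟨hq, MorphismProperty.universally_le _ _ huniv, huniv⟩
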